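/- Let $G$ be a chart group, i.e. a group endowed with a compact Hausdorff topology such that every right shift $x\mapsto xs$ ($s\in G$) is continuous and such that the topological center $\Lambda(G)=\{s\in G : x\mapsto sx \text{ is continuous on } G\}$ is dense in $G$. Call an ultrafilter $u$ on a group (regarded as a discrete set) a Schur ultrafilter if for each $U\in u$ there exist (not necessarily distinct) $x,y\in U$ with $xy\in U$. Then the following conditions are equivalent: (i) $G$ is a topological group (that is, multiplication $G\times G\to G$ and inversion $G\to G$ are continuous); (ii) every Schur ultrafilter on $G$ converges to the identity $1_G$; (iii) there exists a subgroup $H$ of $G$ with $H\subseteq\Lambda(G)$ and $H$ dense in $G$ such that every Schur ultrafilter on $H$ converges to $1_G$ in $G$ (that is, for each neighborhood $V$ of $1_G$ in $G$, $V\cap H$ belongs to the ultrafilter). -/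

import Mathlib

open Filter Topology

/-- A semigroup with a topology is right topological if every right shift `x ↦ x * s`
is continuous. -/
def IsRightTopological (S : Type*) [Semigroup S] [TopologicalSpace S] : Prop :=
  ∀ s : S, Continuous fun x : S => x * s

/-- The topological center: the set of all `s` whose left shift `x ↦ s * x` is continuous. -/
def topologicalCenter (S : Type*) [Semigroup S] [TopologicalSpace S] : Set S :=
  {s : S | Continuous fun x : S => s * x}

/-- A chart group: a compact Hausdorff right topological group whose topological center is
dense. -/
structure IsChartGroup (G : Type*) [Group G] [TopologicalSpace G] : Prop where
  compactSpace : CompactSpace G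
  t2Space : T2Space G
  rightTopological : IsRightTopological G
  dense_center : Dense (topologicalCenter G)

/-- An ultrafilter `u` on a group is Schur if each `U ∈ u` contains `x`, `y` (not necessarily
distinct) and their product `x * y`. -/
def IsSchur {G : Type*} [Group G] (u : Ultrafilter G) : Prop :=
  ∀ U ∈ u, ∃ x ∈ U, ∃ y ∈ U, x * y ∈ U

/-! The substantial direction is from `H` to `G`. If an ultrafilter `p` on `H` tends to `g`, its
difference ultrafilter, the limit of `x⁻¹ * y` in `y` and then in `x`, is Schur, hence tends to `1`.
Left shifts by elements of `H` are continuous, so `x⁻¹ * g → 1` along `p`, and a right shift gives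
`x⁻¹ → g⁻¹`. By density and regularity inversion is continuous; conjugating right shifts by it makes
left shifts continuous, and Ellis' theorem gives joint continuity. Conversely, in a topological
group the limit `g` of a Schur ultrafilter satisfies `g * g = g`. -/

/-! ### Uniform oscillation of separately continuous functions -/

/-- Every operation sending finite sets to points leaves some countable set invariant. -/
theorem exists_countable_closed_finset {α β : Type*} [Countable β] (h : Finset (α × β) → α) :
    ∃ S : Set α, S.Countable ∧
      ∀ F : Finset (α × β), (∀ t ∈ F, t.1 ∈ S) → h F ∈ S := by
  let step : Set α → Set α := fun S => S ∪ h '' {F | ∀ t ∈ F, t.1 ∈ S}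
  have hstep : ∀ S : Set α, S.Countable → (step S).Countable := by
    intro S hS
    refine hS.union (Set.Countable.image ?_ h)
    have h1 : {T : Set (α × β) | T.Finite ∧ T ⊆ S ×ˢ Set.univ}.Countable :=
      Set.countable_ofPred_finite_subset (hS.prod Set.countable_univ)
    refine (h1.preimage (f := fun F : Finset (α × β) => (F : Set (α × β)))
      Finset.coe_injective).mono ?_
    intro F hF
    exact ⟨F.finite_toSet, fun t ht => ⟨hF t ht, trivial⟩⟩
  let S : ℕ → Set α := fun n => step^[n] {h ∅}
  have hsucc : ∀ n, S (n + 1) = step (S n) := fun n => Function.iterate_succ_apply' _ _ _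
  have hmono : Monotone S := monotone_nat_of_le_succ fun n => by
    rw [hsucc]; exact Set.subset_union_left
  refine ⟨⋃ n, S n, Set.countable_iUnion fun n => ?_, fun F hF => ?_⟩
  · induction n with
    | zero => exact Set.countable_singleton _
    | succ n ih => rw [hsucc]; exact hstep _ ih
  · obtain ⟨n, hn⟩ : ∃ n, ∀ t ∈ F, t.1 ∈ S n := by
      choose! k hk using fun t ht => Set.mem_iUnion.1 (hF t ht)
      exact ⟨F.sup k, fun t ht => hmono (Finset.le_sup ht) (hk t ht)⟩
    refine Set.mem_iUnion.2 ⟨n + 1, ?_⟩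
    rw [hsucc]
    exact Or.inr ⟨F, hn, rfl⟩

/-- A separately continuous function on the product of a separable Baire space and a compact
space has small oscillation in the first variable on some nonempty open set, uniformly in the
second variable. -/
theorem exists_isOpen_uniform_oscillation_of_separable {X Y : Type*} [TopologicalSpace X]
    [BaireSpace X] [TopologicalSpace.SeparableSpace X] [Nonempty X]
    [TopologicalSpace Y] [CompactSpace Y] (f : X → Y → ℝ) (hx : ∀ y, Continuous fun x => f x y) (hy : ∀ x, Continuous (f x))
    {ε : ℝ} (hε : 0 < ε) :
    ∃ O : Set X, IsOpen O ∧ O.Nonempty ∧ ∀ x ∈ O, ∀ x' ∈ O, ∀ y, |f x y - f x' y| ≤ 4 * ε := by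
  let d : ℕ → X := TopologicalSpace.denseSeq X
  let C : ℕ → Set (Y × Y) := fun n => {p | ∀ i ≤ n, |f (d i) p.1 - f (d i) p.2| ≤ 1 / (n + 1)}
  have hC : ∀ n, IsClosed (C n) := fun n => by
    simp only [C, Set.ofPred_forall]
    refine isClosed_iInter fun i => isClosed_iInter fun _ => isClosed_le ?_ continuous_const
    have := hy (d i)
    fun_prop
  have hCanti : ∀ n, C (n + 1) ⊆ C n := by
    intro n p hp i hi
    refine (hp i (by omega)).trans ?_
    push_cast
    gcongr
    linarith
  let F : ℕ → Set X := fun n => {x | ∀ p ∈ C n, |f x p.1 - f x p.2| ≤ ε}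
  have hF : ∀ n, IsClosed (F n) := fun n => by
    simp only [F, Set.ofPred_forall]
    refine isClosed_iInter fun p => isClosed_iInter fun _ => isClosed_le ?_ continuous_const
    have := hx p.1
    have := hx p.2
    fun_prop
  -- Otherwise compactness yields a pair in every `C n` that `f x` separates by `ε`; but such a pair
  -- is not separated at any point of the dense sequence, hence nowhere.
  have hcover : ⋃ n, F n = Set.univ := by
    refine Set.eq_univ_of_forall fun x => ?_
    by_contra hcon
    simp only [Set.mem_iUnion, not_exists] at hcon
    have hcl : IsClosed {p : Y × Y | ε ≤ |f x p.1 - f x p.2|} := by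
      refine isClosed_le continuous_const ?_
      have := hy x
      fun_prop
    obtain ⟨p, hp⟩ := IsCompact.nonempty_iInter_of_sequence_nonempty_isCompact_isClosed
      (fun n => C n ∩ {p : Y × Y | ε ≤ |f x p.1 - f x p.2|})
      (fun n => Set.inter_subset_inter_left _ (hCanti n))
      (fun n => by
        have := hcon n
        simp only [F, Set.mem_ofPred_eq, not_forall, not_le] at this
        obtain ⟨p, hp, h⟩ := this
        exact ⟨p, hp, h.le⟩)
      ((hC 0).inter hcl).isCompact (fun n => (hC n).inter hcl)
    simp only [Set.mem_iInter, Set.mem_inter_iff] at hp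
    have heq : (fun z => f z p.1) = fun z => f z p.2 := by
      refine Continuous.ext_on (TopologicalSpace.denseRange_denseSeq X) (hx _) (hx _) ?_
      rintro _ ⟨i, rfl⟩
      have hlim : Tendsto (fun n : ℕ => 1 / ((n : ℝ) + 1)) atTop (𝓝 0) :=
        tendsto_one_div_add_atTop_nhds_zero_nat
      have : |f (d i) p.1 - f (d i) p.2| ≤ 0 :=
        ge_of_tendsto hlim (eventually_atTop.2 ⟨i, fun n hn => (hp n).1 i hn⟩)
      exact sub_eq_zero.1 (abs_nonpos_iff.1 this)
    have h0 : ε ≤ |f x p.1 - f x p.2| := (hp 0).2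
    have h1 : f x p.1 = f x p.2 := congrFun heq x
    rw [h1, sub_self, abs_zero] at h0
    linarith
  obtain ⟨n, z, hz⟩ := nonempty_interior_of_iUnion_of_closed hF hcover
  obtain ⟨T, -, hT⟩ := isCompact_univ.elim_nhds_subcover
    (fun t : Y => {y | (y, t) ∈ C n}) (fun t _ => by
      have : {y | (y, t) ∈ C n} = ⋂ i ∈ Set.Iic n, {y | |f (d i) y - f (d i) t| ≤ 1 / (n + 1)} := by
        ext y; simp [C]
      rw [this, Filter.biInter_mem (Set.finite_Iic n)]
      intro i _
      have hc : Continuous fun y => |f (d i) y - f (d i) t| := by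
        have := hy (d i)
        fun_prop
      refine (hc.tendsto t).eventually (Iic_mem_nhds ?_)
      rw [sub_self, abs_zero]
      positivity)
  -- The four `ε` come from the chain `f x y`, `f x t`, `f z t`, `f x' t`, `f x' y`.
  refine ⟨interior (F n) ∩ ⋂ t ∈ T, {x | |f x t - f z t| < ε}, ?_, ⟨z, hz, ?_⟩, ?_⟩
  · refine isOpen_interior.inter (isOpen_biInter_finset fun t _ => isOpen_lt ?_ continuous_const)
    have := hx t
    fun_prop
  · simp [hε]
  · have key : ∀ x ∈ interior (F n) ∩ ⋂ t ∈ T, {x | |f x t - f z t| < ε}, ∀ y, ∃ t ∈ T,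
        (y, t) ∈ C n ∧ |f x y - f x t| ≤ ε := by
      intro x hx y
      obtain ⟨t, ht, hyt⟩ := Set.mem_iUnion₂.1 (hT (Set.mem_univ y))
      exact ⟨t, ht, hyt, interior_subset hx.1 (y, t) hyt⟩
    intro x hx x' hx' y
    obtain ⟨t, ht, hyt, h1⟩ := key x hx y
    have h2 : |f x' y - f x' t| ≤ ε := interior_subset hx'.1 (y, t) hyt
    have h3 : |f x t - f z t| < ε := Set.mem_iInter₂.1 hx.2 t ht
    have h4 : |f x' t - f z t| < ε := Set.mem_iInter₂.1 hx'.2 t ht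
    rw [abs_le] at *
    rw [abs_lt] at h3 h4
    constructor <;> linarith [h1.1, h1.2, h2.1, h2.2, h3.1, h3.2, h4.1, h4.2]

/-- A separately continuous function on a product of compact spaces has small oscillation in the
first variable on some nonempty open set, uniformly in the second variable. -/
theorem exists_isOpen_uniform_oscillation {X Y : Type*} [TopologicalSpace X] [CompactSpace X]
    [Nonempty X] [TopologicalSpace Y] [CompactSpace Y] (f : X → Y → ℝ)
    (hx : ∀ y, Continuous fun x => f x y) (hy : ∀ x, Continuous (f x)) {ε : ℝ} (hε : 0 < ε) :
    ∃ O : Set X, IsOpen O ∧ O.Nonempty ∧ ∀ x ∈ O, ∀ x' ∈ O, ∀ y, |f x y - f x' y| ≤ 4 * ε := by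
  by_contra! hcon
  -- Each nonempty rational box has a witness `h F` of large oscillation. Closing a countable `S ⊆
  -- Y` under `h` reduces to the image of `X` in `S → ℝ`, which is separable.
  let B : Finset (Y × ℚ × ℚ) → Set X := fun F =>
    {x | ∀ t ∈ F, (t.2.1 : ℝ) < f x t.1 ∧ f x t.1 < t.2.2}
  have hB : ∀ F, IsOpen (B F) := fun F => by
    have : B F = ⋂ t ∈ F, {x | (t.2.1 : ℝ) < f x t.1 ∧ f x t.1 < t.2.2} := by ext; simp [B]
    rw [this]
    exact isOpen_biInter_finset fun t _ =>
      (isOpen_lt continuous_const (hx _)).inter (isOpen_lt (hx _) continuous_const)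
  have hY : ∀ F, ∃ y, (B F).Nonempty → ∃ x ∈ B F, ∃ x' ∈ B F, 4 * ε < |f x y - f x' y| := by
    intro F
    by_cases hF : (B F).Nonempty
    · obtain ⟨x, h, x', h', y, hxy⟩ := hcon _ (hB F) hF
      exact ⟨y, fun _ => ⟨x, h, x', h', hxy⟩⟩
    · obtain ⟨_, _, _, _, y, _⟩ := hcon Set.univ isOpen_univ Set.univ_nonempty
      exact ⟨y, fun h => absurd h hF⟩
  choose h hh using hY
  obtain ⟨S, hSc, hS⟩ := exists_countable_closed_finset h
  have : Countable S := hSc.to_subtype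
  let Φ : X → S → ℝ := fun x s => f x s
  have hΦ : Continuous Φ := continuous_pi fun s => hx s
  let Z := Set.range Φ
  have : CompactSpace Z := isCompact_iff_compactSpace.1 (isCompact_range hΦ)
  let π : X → Z := Set.rangeFactorization Φ
  have hπs : Function.Surjective π := Set.rangeFactorization_surjective
  have hπc : Continuous π := hΦ.subtype_mk _
  have hπ : IsQuotientMap π := hπc.isClosedMap.isQuotientMap hπc hπs
  let r : Z → X := Function.surjInv hπs
  have hr : ∀ z, π (r z) = z := Function.surjInv_eq hπs
  have : CompactSpace (closure S) := isCompact_iff_compactSpace.1 isClosed_closure.isCompact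
  have hagree : ∀ x x', π x = π x' → ∀ y ∈ closure S, f x y = f x' y := by
    intro x x' hxx y hyS
    refine Set.EqOn.closure (s := S) (fun s hs => ?_) (hy x) (hy x') hyS
    exact congrFun (congrArg Subtype.val hxx) ⟨s, hs⟩
  obtain ⟨W, hW, ⟨w, hwW⟩, hosc⟩ := exists_isOpen_uniform_oscillation_of_separable
    (fun (z : Z) (y : closure S) => f (r z) y)
    (fun y => by
      rw [hπ.continuous_iff]
      convert hx y using 2 with x
      exact hagree _ _ (hr _) y y.2)
    (fun z => (hy _).comp continuous_subtype_val) hε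
  obtain ⟨W', hW', rfl⟩ := isOpen_induced_iff.1 hW
  obtain ⟨I, u, hu, huW⟩ := isOpen_pi_iff.1 hW' w.1 hwW
  have hq : ∀ s : S, ∃ q : ℚ × ℚ, s ∈ I → (q.1 : ℝ) < w.1 s ∧ w.1 s < q.2 ∧
      ∀ a : ℝ, q.1 < a → a < q.2 → a ∈ u s := by
    intro s
    by_cases hs : s ∈ I
    · obtain ⟨l, m, hlm, hsub⟩ := mem_nhds_iff_exists_Ioo_subset.1
        ((hu s hs).1.mem_nhds (hu s hs).2)
      obtain ⟨p, hp1, hp2⟩ := exists_rat_btwn hlm.1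
      obtain ⟨q, hq1, hq2⟩ := exists_rat_btwn hlm.2
      exact ⟨(p, q), fun _ => ⟨hp2, hq1, fun a h1 h2 => hsub ⟨hp1.trans h1, h2.trans hq2⟩⟩⟩
    · exact ⟨0, fun h => absurd h hs⟩
  choose q hq using hq
  classical
  -- A box over points of `S` that maps into `W'`: its witness lies in `S`, where the oscillation is
  -- already small.
  let F : Finset (Y × ℚ × ℚ) := I.image fun s => (s.1, q s)
  have hBW : ∀ x ∈ B F, π x ∈ Subtype.val ⁻¹' W' := by
    intro x hxB
    refine huW fun s hs => ?_
    have := hxB (s.1, q s) (Finset.mem_image_of_mem _ hs)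
    exact (hq s hs).2.2 _ this.1 this.2
  have hFS : h F ∈ S := hS F fun t ht => by
    obtain ⟨s, -, rfl⟩ := Finset.mem_image.1 ht
    exact s.2
  have hFn : (B F).Nonempty := by
    refine ⟨r w, fun t ht => ?_⟩
    obtain ⟨s, hs, rfl⟩ := Finset.mem_image.1 ht
    have : f (r w) s = w.1 s := congrFun (congrArg Subtype.val (hr w)) s
    simp only [this]
    exact ⟨(hq s hs).1, (hq s hs).2.1⟩
  obtain ⟨x, hxF, x', hxF', hlt⟩ := hh F hFn
  have hle := hosc _ (hBW x hxF) _ (hBW x' hxF') ⟨h F, subset_closure hFS⟩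
  simp only [hagree _ _ (hr (π x)) _ (subset_closure hFS),
    hagree _ _ (hr (π x')) _ (subset_closure hFS)] at hle
  linarith

/-! ### Ellis' theorem -/

/-- **Ellis' theorem** for compact groups: a compact Hausdorff group with separately continuous
multiplication has jointly continuous multiplication. -/
theorem continuousMul_of_separatelyContinuous {G : Type*} [Group G] [TopologicalSpace G]
    [CompactSpace G] [T2Space G] (hr : ∀ s : G, Continuous fun x : G => x * s)
    (hl : ∀ s : G, Continuous fun x : G => s * x) : ContinuousMul G := by
  have h1 : Tendsto (fun p : G × G => p.1 * p.2) (𝓝 (1, 1)) (𝓝 1) := by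
    intro U hU
    obtain ⟨V, hVU, hV, h1V⟩ := mem_nhds_iff.1 hU
    obtain ⟨φ, hφ0, hφ1, -⟩ := exists_continuous_zero_one_of_isClosed
      (isClosed_singleton (x := (1 : G))) hV.isClosed_compl
      (Set.disjoint_left.2 fun x hx hx' => hx' (by rwa [Set.mem_singleton_iff.1 hx]))
    obtain ⟨O, hO, ⟨a, ha⟩, hosc⟩ := exists_isOpen_uniform_oscillation
      (fun x y : G => φ (x * y)) (fun y => φ.continuous.comp (hr y))
      (fun x => φ.continuous.comp (hl x)) (ε := 1 / 8) (by norm_num)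
    have hx : ∀ᶠ x in 𝓝 (1 : G), x * a ∈ O :=
      ((hr a).tendsto 1).eventually (hO.mem_nhds (by rwa [one_mul]))
    have hy : ∀ᶠ y in 𝓝 (1 : G), φ y < 1 / 2 :=
      (φ.continuous.tendsto 1).eventually (Iio_mem_nhds (by rw [hφ0 rfl]; norm_num))
    rw [nhds_prod_eq, mem_map]
    filter_upwards [hx.prod_mk hy] with p hp
    refine hVU ?_
    by_contra hpV
    have h2 : φ (p.1 * p.2) = 1 := hφ1 hpV
    -- The factor `a⁻¹` cancels `a`, so this compares `φ (p.1 * p.2)` with `φ p.2` up to `4 * (1 /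
    -- 8)`.
    have h3 := hosc _ hp.1 _ ha (a⁻¹ * p.2)
    simp only [mul_assoc, mul_inv_cancel_left, h2] at h3
    linarith [(abs_le.1 h3).2, hp.2]
  refine ⟨continuous_iff_continuousAt.2 fun ⟨a, b⟩ => ?_⟩
  have h2 : Tendsto (fun p : G × G => (a⁻¹ * p.1, p.2 * b⁻¹)) (𝓝 (a, b)) (𝓝 (1, 1)) := by
    have : Continuous fun p : G × G => (a⁻¹ * p.1, p.2 * b⁻¹) :=
      ((hl a⁻¹).comp continuous_fst).prodMk ((hr b⁻¹).comp continuous_snd)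
    simpa using this.tendsto (a, b)
  have h3 := (((hr b).comp (hl a)).tendsto 1).comp (h1.comp h2)
  simpa [Function.comp_def, ContinuousAt, mul_assoc] using h3

/-! ### Schur ultrafilters and inversion -/

/-- The difference ultrafilter of `p`, i.e. the iterated limit of `x⁻¹ * y` as `y` and then `x`
tend to `p`, is Schur. -/
theorem isSchur_bind_inv_mul {H : Type*} [Group H] (p : Ultrafilter H) :
    IsSchur (p.bind fun x => p.map fun y => x⁻¹ * y) := by
  intro U hU
  have hA : ∀ᶠ x in (p : Filter H), ∀ᶠ y in (p : Filter H), x⁻¹ * y ∈ U := hU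
  -- The Schur triple is `(x⁻¹ * y) * (y⁻¹ * z) = x⁻¹ * z`.
  obtain ⟨x, hx⟩ := hA.exists
  obtain ⟨y, hxy, hy⟩ := (hx.and hA).exists
  obtain ⟨z, hxz, hyz⟩ := (hx.and hy).exists
  exact ⟨x⁻¹ * y, hxy, y⁻¹ * z, hyz, by simpa [mul_assoc] using hxz⟩

theorem IsSchur.map {H G : Type*} [Group H] [Group G] {u : Ultrafilter H} (hu : IsSchur u)
    (f : H →* G) : IsSchur (u.map f) := by
  intro U hU
  obtain ⟨x, hx, y, hy, hxy⟩ := hu _ hU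
  exact ⟨f x, hx, f y, hy, by rw [← map_mul]; exact hxy⟩

/-- In a compact Hausdorff topological group, Schur ultrafilters converge to the identity. -/
theorem IsSchur.le_nhds_one {G : Type*} [Group G] [TopologicalSpace G] [CompactSpace G]
    [T2Space G] [ContinuousMul G] {u : Ultrafilter G} (hu : IsSchur u) : (u : Filter G) ≤ 𝓝 1 := by
  obtain ⟨g, hg⟩ : ∃ g, (u : Filter G) ≤ 𝓝 g := ⟨u.lim, u.le_nhds_lim⟩
  suffices g = 1 by rwa [← this]
  by_contra hne
  have hgg : g * g ≠ g := fun h => hne (mul_eq_left.1 h)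
  obtain ⟨A, B, hA, hB, hgA, hgB, hAB⟩ := t2_separation hgg
  have hmul : Tendsto (fun p : G × G => p.1 * p.2) (𝓝 g ×ˢ 𝓝 g) (𝓝 (g * g)) := by
    rw [← nhds_prod_eq]; exact continuous_mul.tendsto (g, g)
  obtain ⟨C, hC, hCA⟩ := mem_prod_same_iff.1 (hmul (hA.mem_nhds hgA))
  obtain ⟨x, hx, y, hy, hxy⟩ := hu _ (hg (inter_mem hC (hB.mem_nhds hgB)))
  exact Set.disjoint_left.1 hAB (hCA (Set.mk_mem_prod hx.1 hy.1)) hxy.2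

/-- The topological center of a compact Hausdorff group, as a subgroup. -/
def topologicalCenterSubgroup (G : Type*) [Group G] [TopologicalSpace G] [CompactSpace G]
    [T2Space G] : Subgroup G where
  carrier := topologicalCenter G
  one_mem' := by simpa [topologicalCenter] using continuous_id'
  mul_mem' {a b} ha hb := by
    simpa [topologicalCenter, mul_assoc, Function.comp_def] using Continuous.comp ha hb
  inv_mem' {a} ha := Continuous.continuous_symm_of_equiv_compact_to_t2 (f := Equiv.mulLeft a) ha

/-- If Schur ultrafilters on a dense subgroup of the topological center converge to the identity,
then inversion is continuous. -/
theorem continuous_inv_of_isSchur_tendsto {G : Type*} [Group G] [TopologicalSpace G]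
    [CompactSpace G] [T2Space G] (hG : IsRightTopological G) (H : Subgroup G)
    (hH : (H : Set G) ⊆ topologicalCenter G) (hd : Dense (H : Set G))
    (hS : ∀ u : Ultrafilter H, IsSchur u → Tendsto ((↑) : H → G) (u : Filter H) (𝓝 (1 : G))) :
    Continuous fun x : G => x⁻¹ := by
  have key : ∀ g : G, Tendsto (fun x : H => (x : G)⁻¹) (comap (↑) (𝓝 g)) (𝓝 g⁻¹) := by
    intro g
    rw [tendsto_iff_ultrafilter]
    intro p hp
    have hpg : Tendsto ((↑) : H → G) (p : Filter H) (𝓝 g) := tendsto_iff_comap.2 hp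
    have h1 : Tendsto (fun x : H => (x : G)⁻¹ * g) (p : Filter H) (𝓝 1) := by
      -- Closed neighborhoods keep the inner limit `x⁻¹ * g` inside `V`.
      refine (closed_nhds_basis (1 : G)).tendsto_right_iff.2 fun V ⟨hV, hVc⟩ => ?_
      have hV' : ∀ᶠ x in (p : Filter H), ∀ᶠ y in (p : Filter H), ((x⁻¹ * y : H) : G) ∈ V :=
        hS _ (isSchur_bind_inv_mul p) hV
      filter_upwards [hV'] with x hx
      have hc : Continuous fun y : G => ((x⁻¹ : H) : G) * y := hH (x⁻¹).2
      exact hVc.mem_of_tendsto ((hc.tendsto g).comp hpg) hx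
    simpa [Function.comp_def] using ((hG g⁻¹).tendsto 1).comp h1
  have hi : IsDenseInducing ((↑) : H → G) := hd.isDenseInducing_val
  have hext : hi.extend (fun x : H => (x : G)⁻¹) = fun x => x⁻¹ :=
    funext fun g => hi.extend_eq_of_tendsto (key g)
  rw [← hext]
  exact hi.continuous_extend fun g => ⟨_, key g⟩

theorem theorem2p9 (G : Type*) [Group G] [TopologicalSpace G] (hG : IsChartGroup G) :
    List.TFAE [
      IsTopologicalGroup G,
      ∀ u : Ultrafilter G, IsSchur u → (u : Filter G) ≤ 𝓝 (1 : G),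
      ∃ H : Subgroup G, (H : Set G) ⊆ topologicalCenter G ∧ Dense (H : Set G) ∧
        ∀ u : Ultrafilter H, IsSchur u → Tendsto ((↑) : H → G) (u : Filter H) (𝓝 (1 : G))] := by
  have := hG.compactSpace
  have := hG.t2Space
  tfae_have 1 → 2 := fun _ _ hu => hu.le_nhds_one
  tfae_have 2 → 3 := fun h => ⟨topologicalCenterSubgroup G, subset_rfl, hG.dense_center,
    fun u hu => h _ (hu.map (topologicalCenterSubgroup G).subtype)⟩
  tfae_have 3 → 1 := by
    rintro ⟨H, hH, hd, hS⟩
    have hinv := continuous_inv_of_isSchur_tendsto hG.rightTopological H hH hd hS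
    have hleft : ∀ s : G, Continuous fun x : G => s * x := fun s => by
      simpa [Function.comp_def] using hinv.comp ((hG.rightTopological s⁻¹).comp hinv)
    have := continuousMul_of_separatelyContinuous hG.rightTopological hleft
    exact { continuous_inv := hinv }
  tfae_finish
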